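/- Let $d\in\mathbb N$, $T>0$ and $G\ge 0$. Let $\mathcal G$ be the set of positive Radon measures on $\mathbb R^d$ with total mass at most $G$ and finite first order moment, equipped with the distance $$\mathcal W(\mu,\mu')=\sup\Big\{\int\phi\,d(\mu-\mu'):\phi\in C^0_c(\mathbb R^d),\ \|\phi\|_\infty\le 1,\ \operatorname{Lip}(\phi)\le 1\Big\}.$$ **Data.** Let $b:\mathbb R^d\times\mathbb R\to\mathbb R^d$ be bounded, continuous, and Lipschitz continuous in $x$ uniformly in $t$, and let $\Phi(x,t,\cdot)$ be the solution of $y'(s)=b(y(s),s)$, $y(t)=x$. Let the sink $\mathcal S\subset\mathbb R^d$ be closed, with boundary $\partial\mathcal S$ compact and of class $C^1$ (near each of its points, $\partial\mathcal S$ is the zero set of a $C^1$ function with nonvanishing derivative). For $x\in\mathbb R^d$ and $s,t,\tau\ge0$ put $$t_x=\inf\{t\ge 0:\Phi(x,0,t)\in\mathcal S\}\in[0,+\infty],\qquad \mathcal B(s)=\{x:t_x\le s\},\qquad \mathcal B^\tau=\{x:t_x=\tau\},$$ $$\mathcal S^t=\{z\in\partial\mathcal S:\ \exists x\in\mathbb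 R^d,\ t_x=t,\ \Phi(x,0,t)=z\}.$$ Let $m_0\in\mathcal G$ and let $\tilde m_0$ be the measure equal to $m_0$ on $\mathbb R^d\setminus\mathcal S$ and to $0$ on $\mathcal S$; assume that $\tilde m_0$ is absolutely continuous with a bounded, compactly supported density. Assume that for every $s\in[0,T]$ the map $\pi:\mathcal B(s)\to[0,s]$, $\pi(x)=t_x$, is Lipschitz continuous. **Weak solutions.** A path $\mu$ on $[0,T]$ is a *weak solution* of the continuity equation with sink $$\mu_t+\operatorname{div}(\mu b)+\mathbb 1_{\{(\mathcal S^t,t):t\in[0,T]\}}\mu=0\ \text{ on }\mathbb R^d\times[0,T],\qquad \mu(\cdot,0)=\tilde m_0,$$ if the following two conditions hold. 1. $\mu\in L^1([0,T],\mathcal G)$: $\mu(t)\in\mathcal G$ for every $t\in[0,T]$, and $t\mapsto\mu(t)$ is strongly measurable with respect to $\mathcal W$, with $\int_0^T\mathcal W(\mu(t),0)\,dt<\infty$. 2. The measure $\nu=\pi\#(\mu(0)|_{\mathcal B(T)})$ on $[0,T]$ has a density $g$ with respect to Lebesgue measure, and there is a measurable family of probability measures $(\mu^\tau(0))_\tau$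 disintegrating $\mu(0)$ on the fibers $\mathcal B^\tau$, i.e. $$\mu(0)(A)=\int_{[0,t]}\mu^\tau(0)(\mathcal B^\tau\cap A)\,d\nu(\tau)=\int_0^t g(\tau)\,\mu^\tau(0)(\mathcal B^\tau\cap A)\,d\tau$$ for all $t\in[0,T]$ and all Borel $A\subseteq\mathcal B(t)$, such that, with $$\mu^t(t):=g(t)\,\big(\Phi(\cdot,0,t)\#\mu^t(0)\big),$$ for every $\phi\in C_c^\infty(\mathbb R^d\times[0,T[)$ the two integrals over $[0,T]$ below have integrable integrands in $t$ and $$\int_{\mathbb R^d}\phi(x,0)\,d\tilde m_0(x)+\int_0^T\!\!\int_{\mathbb R^d\setminus\Phi(\mathcal B(t),0,t)}\big(\phi_t(x,t)+\langle D_x\phi(x,t),b(x,t)\rangle\big)\,d\mu(t)(x)\,dt-\int_0^T\!\!\int_{\mathcal S^t}\phi(x,t)\,d\mu^t(t)(x)\,dt=0.$$ **Theorem.** For $s\in[0,T]$ let $\tilde\mu(s)$ be the measure that coincides with $\Phi(\cdot,0,s)\#\tilde m_0$ on $\mathbb R^d\setminus\Phi(\mathcal B(s),0,s)$ and vanishes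 on $\Phi(\mathcal B(s),0,s)$. Then $s\mapsto\tilde\mu(s)$ is a weak solution, in the above sense, of the continuity equation with sink. -/

import Mathlib

open Set MeasureTheory
open scoped NNReal ENNReal ContDiff

noncomputable section

namespace SinkFlow

/-- The space `ℝ^d` with its Euclidean norm. -/
abbrev E (d : ℕ) : Type := EuclideanSpace ℝ (Fin d)

/-! ### Measures of bounded mass and the generalized Wasserstein distance -/

/-- The set `𝒢` of positive Borel (hence, being finite, Radon) measures on `ℝ^d` with total mass at
most `G` and finite first order moment. -/
def massSet (d : ℕ) (G : ℝ≥0) : Set (Measure (E d)) :=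
  {μ | μ univ ≤ (G : ℝ≥0∞) ∧ ∫⁻ x, (‖x‖₊ : ℝ≥0∞) ∂μ < ⊤}

/-- The set `𝒢` as a type, to be equipped with the generalized Wasserstein distance. -/
def MassSpace (d : ℕ) (G : ℝ≥0) : Type := {μ : Measure (E d) // μ ∈ massSet d G}

/-- The competitors in the generalized Wasserstein distance: continuous compactly supported functions
with sup norm at most `1` and Lipschitz constant at most `1`. -/
def wassersteinTests (d : ℕ) : Set (E d → ℝ) :=
  {φ | Continuous φ ∧ HasCompactSupport φ ∧ (∀ x, |φ x| ≤ 1) ∧ LipschitzWith 1 φ}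

/-- The generalized Wasserstein distance `sup_φ ∫ φ d(μ - μ')`. The value is nonnegative because
`φ = 0` is a competitor, so it may be computed in `[0, ∞]`. -/
def wasserstein {d : ℕ} (μ μ' : Measure (E d)) : ℝ≥0∞ :=
  ⨆ φ ∈ wassersteinTests d, ENNReal.ofReal ((∫ x, φ x ∂μ) - ∫ x, φ x ∂μ')

theorem wasserstein_self {d : ℕ} (μ : Measure (E d)) : wasserstein μ μ = 0 := by
  simp [wasserstein]

theorem wasserstein_le_swap {d : ℕ} (μ μ' : Measure (E d)) :
    wasserstein μ μ' ≤ wasserstein μ' μ := by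
  refine iSup₂_le fun φ hφ => ?_
  obtain ⟨h1, h2, h3, h4⟩ := hφ
  have hneg : (fun x => -φ x) ∈ wassersteinTests d := by
    refine ⟨h1.neg, h2.neg, fun x => by simpa using h3 x, ?_⟩
    exact h4.neg
  refine le_trans (le_of_eq ?_)
    (le_iSup₂ (f := fun (ψ : E d → ℝ) (_ : ψ ∈ wassersteinTests d) =>
      ENNReal.ofReal ((∫ x, ψ x ∂μ') - ∫ x, ψ x ∂μ)) (fun x => -φ x) hneg)
  congr 1
  simp only [integral_neg]
  ring

theorem wasserstein_triangle {d : ℕ} (μ₁ μ₂ μ₃ : Measure (E d)) :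
    wasserstein μ₁ μ₃ ≤ wasserstein μ₁ μ₂ + wasserstein μ₂ μ₃ := by
  refine iSup₂_le fun φ hφ => ?_
  have h12 := le_iSup₂ (f := fun (ψ : E d → ℝ) (_ : ψ ∈ wassersteinTests d) =>
      ENNReal.ofReal ((∫ x, ψ x ∂μ₁) - ∫ x, ψ x ∂μ₂)) φ hφ
  have h23 := le_iSup₂ (f := fun (ψ : E d → ℝ) (_ : ψ ∈ wassersteinTests d) =>
      ENNReal.ofReal ((∫ x, ψ x ∂μ₂) - ∫ x, ψ x ∂μ₃)) φ hφ
  refine le_trans ?_ (add_le_add h12 h23)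
  refine le_trans (le_of_eq ?_) ENNReal.ofReal_add_le
  congr 1
  ring

instance instPseudoEMetricSpaceMassSpace (d : ℕ) (G : ℝ≥0) :
    PseudoEMetricSpace (MassSpace d G) where
  edist μ μ' := wasserstein μ.1 μ'.1
  edist_self μ := wasserstein_self μ.1
  edist_comm μ μ' := le_antisymm (wasserstein_le_swap _ _) (wasserstein_le_swap _ _)
  edist_triangle μ₁ μ₂ μ₃ := wasserstein_triangle _ _ _

/-- The zero measure as an element of `𝒢`. -/
def zeroMass (d : ℕ) (G : ℝ≥0) : MassSpace d G := ⟨0, by simp [massSet]⟩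

/-- `μ ∈ L¹([0, T], 𝒢)`: the path takes values in `𝒢` on `[0, T]`, it is strongly measurable for the
generalized Wasserstein distance, and its distance to the zero measure is integrable on `[0, T]`. -/
def MemL1Path {d : ℕ} (G : ℝ≥0) (T : ℝ) (μ : ℝ → Measure (E d)) : Prop :=
  ∃ ρ : ℝ → MassSpace d G,
    (∀ t ∈ Icc 0 T, (ρ t).1 = μ t) ∧
    AEStronglyMeasurable ρ (volume.restrict (Icc 0 T)) ∧
    ∫⁻ t in Icc 0 T, edist (ρ t) (zeroMass d G) < ⊤

/-! ### The flow, the sink and the arrival times -/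

/-- The standing assumptions on the field: bounded, continuous, and Lipschitz continuous in the
space variable uniformly in time. -/
structure IsAdmissibleField {d : ℕ} (b : E d → ℝ → E d) : Prop where
  bounded : ∃ M : ℝ, ∀ x t, ‖b x t‖ ≤ M
  continuous : Continuous fun p : E d × ℝ => b p.1 p.2
  lipschitz : ∃ L : ℝ≥0, ∀ t, LipschitzWith L fun x => b x t

/-- The boundary of `S` is of class `C¹`, that is, a `C¹` hypersurface: near each of its points it
is the zero set of a `C¹` function with nonvanishing derivative. It is not required that `S` lies
on only one side of its boundary. -/
def HasC1Boundary {d : ℕ} (S : Set (E d)) : Prop :=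
  ∀ z ∈ frontier S, ∃ U : Set (E d), IsOpen U ∧ z ∈ U ∧ ∃ f : E d → ℝ,
    ContDiffOn ℝ 1 f U ∧ fderiv ℝ f z ≠ 0 ∧ frontier S ∩ U = {x ∈ U | f x = 0}

/-- The standing assumptions on the sink: closed, with compact boundary of class `C¹`. -/
structure IsAdmissibleSink {d : ℕ} (S : Set (E d)) : Prop where
  isClosed : IsClosed S
  isCompact_frontier : IsCompact (frontier S)
  c1Boundary : HasC1Boundary S

/-- `y` solves `y'(s) = b(y(s), s)` with `y(t) = x`. -/
def IsTrajectory {d : ℕ} (b : E d → ℝ → E d) (x : E d) (t : ℝ) (y : ℝ → E d) : Prop :=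
  y t = x ∧ ∀ s, HasDerivAt y (b (y s) s) s

open Classical in
/-- The flow: `flow b x t s = Φ(x, t, s)` is the value at time `s` of the solution starting from `x`
at time `t`. For an admissible field this solution exists and is unique; the second branch is never
reached. -/
def flow {d : ℕ} (b : E d → ℝ → E d) (x : E d) (t s : ℝ) : E d :=
  if h : ∃ y, IsTrajectory b x t y then h.choose s else x

/-- The possible first arrival time `t_x = inf {t ≥ 0 : Φ(x, 0, t) ∈ S}`, equal to `+∞` if the
trajectory never meets `S`. -/
def arrivalTime {d : ℕ} (b : E d → ℝ → E d) (S : Set (E d)) (x : E d) : EReal :=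
  sInf ((fun t : ℝ => (t : EReal)) '' {t : ℝ | 0 ≤ t ∧ flow b x 0 t ∈ S})

/-- The set `S^t` of possible arrival points on the sink at time `t`. -/
def arrivalSet {d : ℕ} (b : E d → ℝ → E d) (S : Set (E d)) (t : ℝ) : Set (E d) :=
  {z ∈ frontier S | ∃ x, arrivalTime b S x = (t : EReal) ∧ flow b x 0 t = z}

/-- The sink-reaching-points set `B(s) = {x : t_x ≤ s}`. -/
def reachSet {d : ℕ} (b : E d → ℝ → E d) (S : Set (E d)) (s : ℝ) : Set (E d) :=
  {x | arrivalTime b S x ≤ (s : EReal)}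

/-- The fiber `B^τ = {x : t_x = τ}`. -/
def reachFiber {d : ℕ} (b : E d → ℝ → E d) (S : Set (E d)) (τ : ℝ) : Set (E d) :=
  {x | arrivalTime b S x = (τ : EReal)}

/-- The map `π(x) = t_x` as a real-valued function; it is only used on the sets `B(s)`, where `t_x`
is finite. -/
def arrivalMap {d : ℕ} (b : E d → ℝ → E d) (S : Set (E d)) (x : E d) : ℝ :=
  (arrivalTime b S x).toReal

/-- The image `Φ(B(s), 0, s)`: positions at time `s` of the agents that have already met the sink. -/
def removedSet {d : ℕ} (b : E d → ℝ → E d) (S : Set (E d)) (s : ℝ) : Set (E d) :=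
  (fun x => flow b x 0 s) '' reachSet b S s

/-! ### The initial datum and the candidate solution -/

/-- The initial distribution `m̃₀`: the given `m₀` outside the sink, zero on the sink. -/
def initialMeasure {d : ℕ} (S : Set (E d)) (m₀ : Measure (E d)) : Measure (E d) :=
  m₀.restrict Sᶜ

/-- The measure is absolutely continuous with a bounded density of compact support. -/
def HasBoundedCompactDensity {d : ℕ} (m : Measure (E d)) : Prop :=
  ∃ ρ : E d → ℝ≥0, Measurable ρ ∧ (∃ C : ℝ≥0, ∀ x, ρ x ≤ C) ∧ HasCompactSupport ρ ∧
    m = (volume : Measure (E d)).withDensity fun x => (ρ x : ℝ≥0∞)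

/-- The path `μ̃(s)`: the push-forward of `m̃₀` by the flow, set to zero on `Φ(B(s), 0, s)`. -/
def sinkPath {d : ℕ} (b : E d → ℝ → E d) (S : Set (E d)) (m₀ : Measure (E d)) (s : ℝ) :
    Measure (E d) :=
  ((initialMeasure S m₀).map fun x => flow b x 0 s).restrict (removedSet b S s)ᶜ

/-! ### Weak solutions -/

/-- The measure `ν` on `[0, T]`: the law under `m` of the arrival time, `π # (m restricted to B(T))`. -/
def arrivalLaw {d : ℕ} (b : E d → ℝ → E d) (S : Set (E d)) (T : ℝ) (m : Measure (E d)) :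
    Measure ℝ :=
  (m.restrict (reachSet b S T)).map (arrivalMap b S)

/-- `κ` is a disintegration of `m` on the fibers `B^τ`, `0 ≤ τ ≤ T`, into probability measures, and
`g` is the density with respect to the Lebesgue measure of the measure `ν` on the indices `τ`:
`m(E) = ∫_{[0,t]} κ_τ(B^τ ∩ E) dν(τ) = ∫_0^t g(τ) κ_τ(B^τ ∩ E) dτ` for all `E ⊆ B(t)`. -/
structure IsArrivalDisintegration {d : ℕ} (b : E d → ℝ → E d) (S : Set (E d)) (T : ℝ)
    (m : Measure (E d)) (κ : ProbabilityTheory.Kernel ℝ (E d)) (g : ℝ → ℝ≥0) : Prop where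
  isMarkov : ProbabilityTheory.IsMarkovKernel κ
  measurable_density : Measurable g
  law_eq : arrivalLaw b S T m = (volume.restrict (Icc 0 T)).withDensity fun τ => (g τ : ℝ≥0∞)
  eq_lintegral_law : ∀ t ∈ Icc 0 T, ∀ A : Set (E d), MeasurableSet A → A ⊆ reachSet b S t →
    m A = ∫⁻ τ in Icc 0 t, κ τ (reachFiber b S τ ∩ A) ∂(arrivalLaw b S T m)
  eq_lintegral_density : ∀ t ∈ Icc 0 T, ∀ A : Set (E d), MeasurableSet A → A ⊆ reachSet b S t →
    m A = ∫⁻ τ in Icc 0 t, (g τ : ℝ≥0∞) * κ τ (reachFiber b S τ ∩ A)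

/-- The measure `μ^t(t) = g(t) (Φ(·, 0, t) # μ^t(0))`, the mass entering the sink at time `t`. -/
def enteringMeasure {d : ℕ} (b : E d → ℝ → E d) (κ : ProbabilityTheory.Kernel ℝ (E d))
    (g : ℝ → ℝ≥0) (t : ℝ) : Measure (E d) :=
  g t • (κ t).map fun x => flow b x 0 t

/-- The test functions `C_c^∞(ℝ^d × [0, T[)`: restrictions to nonnegative times of smooth functions
on `ℝ^d × ℝ` whose support is compact and contained in `ℝ^d × ]-∞, T[`. -/
def IsTestFunction {d : ℕ} (T : ℝ) (φ : E d × ℝ → ℝ) : Prop :=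
  ContDiff ℝ ∞ φ ∧ HasCompactSupport φ ∧ tsupport φ ⊆ univ ×ˢ Iio T

/-- The quantity `φ_t(x, t) + ⟨D_x φ(x, t), b(x, t)⟩`. -/
def transportTerm {d : ℕ} (b : E d → ℝ → E d) (φ : E d × ℝ → ℝ) (x : E d) (t : ℝ) : ℝ :=
  deriv (fun s => φ (x, s)) t + fderiv ℝ (fun y => φ (y, t)) x (b x t)

/-- `μ` is a weak solution on `[0, T]` of the continuity equation with field `b`, sink `S` and
initial datum `m`. The integrability in time of both integrands is part of the notion. -/
def IsWeakSolution {d : ℕ} (b : E d → ℝ → E d) (S : Set (E d)) (T : ℝ) (G : ℝ≥0)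
    (m : Measure (E d)) (μ : ℝ → Measure (E d)) : Prop :=
  MemL1Path G T μ ∧
  ∃ (κ : ProbabilityTheory.Kernel ℝ (E d)) (g : ℝ → ℝ≥0),
    IsArrivalDisintegration b S T (μ 0) κ g ∧
    ∀ φ : E d × ℝ → ℝ, IsTestFunction T φ →
      IntervalIntegrable
        (fun t => ∫ x in (removedSet b S t)ᶜ, transportTerm b φ x t ∂(μ t)) volume 0 T ∧
      IntervalIntegrable
        (fun t => ∫ x in arrivalSet b S t, φ (x, t) ∂(enteringMeasure b κ g t)) volume 0 T ∧
      (∫ x, φ (x, 0) ∂m)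
        + (∫ t in (0 : ℝ)..T, ∫ x in (removedSet b S t)ᶜ, transportTerm b φ x t ∂(μ t))
        - (∫ t in (0 : ℝ)..T, ∫ x in arrivalSet b S t, φ (x, t) ∂(enteringMeasure b κ g t)) = 0

end SinkFlow

end

/-!
Every point `x` travels along its trajectory `t ↦ Φ(x, 0, t)` until its arrival time `t_x`, and the
candidate at time `s` is the image under `Φ(·, 0, s)` of the initial measure restricted to
`{t_x > s}` (`sinkPath_eq_map`). The weak formulation is the fundamental theorem of calculus along
each trajectory, integrated over the starting points.

The transport term is the derivative of `t ↦ φ(Φ(x, 0, t), t)` (`hasDerivAt_comp_flow`). By Fubini,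
its double integral is the integral over `x` of `φ(Φ(x, 0, t_x), t_x) - φ(x, 0)` if `t_x ≤ T` and of
`-φ(x, 0)` otherwise, since `φ` vanishes at time `T` (`integral_transport`). The term
`φ(Φ(x, 0, t_x), t_x)`, integrated over `B(T)` and disintegrated along `x ↦ t_x`, is the integral of
`φ` against the mass entering the sink (`integral_entering`), so that the three terms of the weak
formulation cancel.

The disintegration is Mathlib's conditional kernel of the joint law of `(t_x, x)`. What has to be
proved is that the law of `t_x` has a density, that is, that arrival times in a Lebesgue null set
`N` correspond to a null set of starting points (`volume_reachFiber_eq_zero`). A starting point with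
`t_x = τ > 0` is `Φ(z, τ, 0)` for the arrival point `z ∈ ∂S`, by running the flow backwards. Hence
these points lie in the image of `N × ∂S` under the map `(τ, z) ↦ Φ(z, τ, 0)`, which is Lipschitz by
Grönwall's inequality. As `∂S` is locally a Lipschitz image of a `(d - 1)`-dimensional space, by the
implicit function theorem, `N × ∂S` is locally a Lipschitz image of a null set of a `d`-dimensional
space, and Lipschitz maps preserve null sets between spaces of equal dimension.

The same null-set statement for a single time shows that the candidate loses no mass in jumps, which
makes it continuous for the generalized Wasserstein distance (`tendsto_wasserstein_sinkPath`), hence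
strongly measurable.
-/

open Filter Topology
open scoped ProbabilityTheory

namespace SinkFlow

variable {d : ℕ} {b : E d → ℝ → E d} {S : Set (E d)}

/-! ### The flow of an admissible field -/

/-- Grönwall's estimate, forward in time. -/
theorem dist_trajectory_le_of_le {L : ℝ≥0} (hL : ∀ t, LipschitzWith L fun x => b x t)
    {y w : ℝ → E d} (hy : ∀ s, HasDerivAt y (b (y s) s) s)
    (hw : ∀ s, HasDerivAt w (b (w s) s) s) {s t : ℝ} (hst : t ≤ s) :
    dist (y s) (w s) ≤ dist (y t) (w t) * Real.exp (L * (s - t)) :=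
  dist_le_of_trajectories_ODE (v := fun t x => b x t) hL
    (fun r _ => (hy r).continuousAt.continuousWithinAt)
    (fun r _ => (hy r).hasDerivWithinAt)
    (fun r _ => (hw r).continuousAt.continuousWithinAt)
    (fun r _ => (hw r).hasDerivWithinAt) le_rfl s ⟨hst, le_rfl⟩

/-- Grönwall's estimate between two trajectories, in either direction of time. -/
theorem dist_trajectory_le {L : ℝ≥0} (hL : ∀ t, LipschitzWith L fun x => b x t)
    {y w : ℝ → E d} (hy : ∀ s, HasDerivAt y (b (y s) s) s)
    (hw : ∀ s, HasDerivAt w (b (w s) s) s) (s t : ℝ) :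
    dist (y s) (w s) ≤ dist (y t) (w t) * Real.exp (L * |s - t|) := by
  rcases le_total t s with h | h
  · rw [abs_of_nonneg (sub_nonneg.2 h)]
    exact dist_trajectory_le_of_le hL hy hw h
  · have hrev : ∀ {z : ℝ → E d}, (∀ s, HasDerivAt z (b (z s) s) s) → ∀ s,
        HasDerivAt (fun r => z (-r)) ((fun x t => -b x (-t)) (z (-s)) s) s := by
      intro z hz s
      have h := (hz (-s)).scomp s (hasDerivAt_neg s)
      rw [neg_one_smul] at h
      exact h
    have := dist_trajectory_le_of_le (b := fun x t => -b x (-t)) (fun t => (hL (-t)).neg)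
      (hrev hy) (hrev hw) (neg_le_neg h)
    rw [abs_of_nonpos (sub_nonpos.2 h)]
    simpa [neg_add_eq_sub] using this

/-- A field bounded by `M` has `M`-Lipschitz trajectories. -/
theorem dist_trajectory_time_le {M : ℝ} (hM : ∀ x t, ‖b x t‖ ≤ M) {y : ℝ → E d}
    (hy : ∀ s, HasDerivAt y (b (y s) s) s) (s t : ℝ) :
    dist (y s) (y t) ≤ M * |s - t| := by
  rw [dist_eq_norm, ← Real.norm_eq_abs]
  exact convex_univ.norm_image_sub_le_of_norm_hasDerivWithin_le
    (fun r _ => (hy r).hasDerivWithinAt) (fun r _ => hM _ _) (mem_univ t) (mem_univ s)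

/-- On a bounded time interval the Picard–Lindelöf theorem applies on a ball whose radius is the
largest distance that a trajectory can travel. -/
theorem exists_trajectory_on_Ioo (hb : IsAdmissibleField b) (x : E d) (t R : ℝ) (hR : 0 < R) :
    ∃ y : ℝ → E d, y t = x ∧ ∀ s ∈ Ioo (t - R) (t + R), HasDerivAt y (b (y s) s) s := by
  obtain ⟨⟨M, hM⟩, hc, L, hL⟩ := hb
  have hM0 : 0 ≤ M := (norm_nonneg _).trans (hM x t)
  have hpl : IsPicardLindelof (fun t x => b x t)
      (⟨t, by constructor <;> linarith⟩ : Icc (t - R) (t + R)) x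
      (NNReal.mk (M * R) (by positivity)) 0 (NNReal.mk M hM0) L := by
    refine ⟨fun s _ => (hL s).lipschitzOnWith, fun z _ => ?_, fun s _ z _ => hM z s, ?_⟩
    · exact (hc.comp (continuous_const.prodMk continuous_id)).continuousOn
    · simp only [add_sub_cancel_left, sub_sub_cancel, max_self, NNReal.coe_zero, sub_zero,
        NNReal.coe_mk, le_refl]
  obtain ⟨y, hy, hy'⟩ := hpl.exists_eq_forall_mem_Icc_hasDerivWithinAt₀
  exact ⟨y, hy, fun s hs => (hy' s (Ioo_subset_Icc_self hs)).hasDerivAt (Icc_mem_nhds hs.1 hs.2)⟩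

/-- The local solutions on the intervals `]t - n - 1, t + n + 1[` agree wherever two of them are
defined, so they glue to a global trajectory. -/
theorem IsAdmissibleField.exists_isTrajectory (hb : IsAdmissibleField b) (x : E d) (t : ℝ) :
    ∃ y, IsTrajectory b x t y := by
  have hpos : ∀ n : ℕ, (0 : ℝ) < n + 1 := fun n => by positivity
  choose Y hY hY' using fun n : ℕ => exists_trajectory_on_Ioo hb x t (n + 1) (hpos n)
  obtain ⟨L, hL⟩ := hb.lipschitz
  have hagree : ∀ m n : ℕ, m ≤ n → EqOn (Y m) (Y n) (Ioo (t - (m + 1)) (t + (m + 1))) := by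
    intro m n hmn
    have hmn' : (m : ℝ) ≤ n := by exact_mod_cast hmn
    refine ODE_solution_unique_of_mem_Ioo (v := fun t x => b x t) (s := fun _ => univ) (K := L)
      (fun s _ => (hL s).lipschitzOnWith) (t₀ := t)
      ⟨by linarith [hpos m], by linarith [hpos m]⟩
      (fun s hs => ⟨hY' m s hs, trivial⟩) (fun s hs => ⟨hY' n s ⟨?_, ?_⟩, trivial⟩)
      ((hY m).trans (hY n).symm)
    · linarith [hs.1]
    · linarith [hs.2]
  -- The value at `s` is taken from the solution of index `⌈|s - t|⌉`, which is defined near `s`.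
  have hmem : ∀ s : ℝ, s ∈ Ioo (t - ((⌈|s - t|⌉₊ : ℕ) + 1 : ℝ)) (t + ((⌈|s - t|⌉₊ : ℕ) + 1)) := by
    intro s
    have h1 := Nat.le_ceil |s - t|
    have h2 := abs_le.1 h1
    exact ⟨by linarith [h2.1], by linarith [h2.2]⟩
  refine ⟨fun s => Y ⌈|s - t|⌉₊ s, by simpa using hY 0, fun s => ?_⟩
  set n := ⌈|s - t|⌉₊ with hn
  refine (hY' n s (hmem s)).congr_of_eventuallyEq ?_
  filter_upwards [Ioo_mem_nhds (hmem s).1 (hmem s).2] with r hr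
  rcases le_total n ⌈|r - t|⌉₊ with h | h
  · exact (hagree _ _ h hr).symm
  · exact hagree _ _ h (hmem r)

theorem IsAdmissibleField.isTrajectory_flow (hb : IsAdmissibleField b) (x : E d) (t : ℝ) :
    IsTrajectory b x t (flow b x t) := by
  have h := hb.exists_isTrajectory x t
  have : flow b x t = h.choose := by
    funext s
    simp [flow, h]
  rw [this]
  exact h.choose_spec

theorem IsAdmissibleField.flow_self (hb : IsAdmissibleField b) (x : E d) (t : ℝ) :
    flow b x t t = x :=
  (hb.isTrajectory_flow x t).1

theorem IsAdmissibleField.hasDerivAt_flow (hb : IsAdmissibleField b) (x : E d) (t s : ℝ) :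
    HasDerivAt (flow b x t) (b (flow b x t s) s) s :=
  (hb.isTrajectory_flow x t).2 s

/-- The flow property, by uniqueness of trajectories. -/
theorem IsAdmissibleField.flow_flow (hb : IsAdmissibleField b) (x : E d) (r t s : ℝ) :
    flow b (flow b x r t) t s = flow b x r s := by
  obtain ⟨L, hL⟩ := hb.lipschitz
  have := dist_trajectory_le hL (hb.hasDerivAt_flow (flow b x r t) t) (hb.hasDerivAt_flow x r) s t
  rw [hb.flow_self, dist_self, zero_mul] at this
  exact dist_le_zero.1 this

theorem IsAdmissibleField.flow_inverse (hb : IsAdmissibleField b) (x : E d) (t s : ℝ) :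
    flow b (flow b x t s) s t = x := by
  rw [hb.flow_flow, hb.flow_self]

theorem IsAdmissibleField.flow_injective (hb : IsAdmissibleField b) (t s : ℝ) :
    Function.Injective fun x => flow b x t s :=
  Function.LeftInverse.injective (g := fun z => flow b z s t) fun x => hb.flow_inverse x t s

/-- The flow, as a function of the starting point, the starting time and the final time, is
Lipschitz in all three variables while the two times stay within a bounded distance. -/
theorem IsAdmissibleField.exists_dist_flow_le (hb : IsAdmissibleField b) :
    ∃ (M : ℝ) (L : ℝ≥0), 0 ≤ M ∧ ∀ x x' t t' s s',
      dist (flow b x t s) (flow b x' t' s') ≤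
        (dist x x' + M * |t - t'|) * Real.exp (L * |s - t|) + M * |s - s'| := by
  obtain ⟨M, hM⟩ := hb.bounded
  obtain ⟨L, hL⟩ := hb.lipschitz
  refine ⟨M, L, (norm_nonneg _).trans (hM 0 0), fun x x' t t' s s' => ?_⟩
  have h1 := dist_trajectory_le hL (hb.hasDerivAt_flow x t) (hb.hasDerivAt_flow x' t') s t
  have h2 := dist_trajectory_time_le hM (hb.hasDerivAt_flow x' t') s s'
  have h3 := dist_trajectory_time_le hM (hb.hasDerivAt_flow x' t') t' t
  rw [hb.flow_self] at h1 h3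
  have h4 : dist x (flow b x' t' t) ≤ dist x x' + M * |t - t'| := by
    rw [abs_sub_comm]; exact (dist_triangle _ _ _).trans (by gcongr)
  calc _ ≤ dist (flow b x t s) (flow b x' t' s) + dist (flow b x' t' s) (flow b x' t' s') :=
        dist_triangle _ _ _
    _ ≤ _ := add_le_add (h1.trans (by gcongr)) h2

theorem IsAdmissibleField.continuous_flow (hb : IsAdmissibleField b) :
    Continuous fun p : E d × ℝ × ℝ => flow b p.1 p.2.1 p.2.2 := by
  obtain ⟨M, L, -, h⟩ := hb.exists_dist_flow_le
  refine continuous_iff_continuousAt.2 fun p => ?_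
  refine tendsto_iff_dist_tendsto_zero.2 ?_
  refine squeeze_zero (fun _ => dist_nonneg) (fun q => h q.1 p.1 q.2.1 p.2.1 q.2.2 p.2.2) ?_
  have : Continuous fun q : E d × ℝ × ℝ => (dist q.1 p.1 + M * |q.2.1 - p.2.1|) *
      Real.exp (L * |q.2.2 - q.2.1|) + M * |q.2.2 - p.2.2| := by fun_prop
  simpa using this.tendsto p

theorem IsAdmissibleField.continuous_flow_zero (hb : IsAdmissibleField b) :
    Continuous fun p : E d × ℝ => flow b p.1 0 p.2 :=
  hb.continuous_flow.comp (continuous_fst.prodMk (continuous_const.prodMk continuous_snd))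

theorem IsAdmissibleField.continuous_flow_left (hb : IsAdmissibleField b) (t s : ℝ) :
    Continuous fun x => flow b x t s :=
  hb.continuous_flow.comp
    (continuous_id.prodMk (continuous_const.prodMk continuous_const))

/-! ### Arrival times and the sets reaching the sink -/

/-- The times `t ≥ 0` at which the trajectory issued from `x` at time `0` lies in the sink. -/
def hitSet (b : E d → ℝ → E d) (S : Set (E d)) (x : E d) : Set ℝ :=
  {t : ℝ | 0 ≤ t ∧ flow b x 0 t ∈ S}

theorem arrivalTime_nonneg (x : E d) : 0 ≤ arrivalTime b S x := by
  refine le_sInf ?_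
  rintro _ ⟨t, ht, rfl⟩
  exact EReal.coe_nonneg.2 ht.1

theorem arrivalTime_eq_of_isLeast {x : E d} {t : ℝ} (h : IsLeast (hitSet b S x) t) :
    arrivalTime b S x = t :=
  (EReal.coe_strictMono.monotone.map_isLeast h).isGLB.sInf_eq

/-- The infimum defining a finite arrival time is attained, because the sink is closed. -/
theorem exists_isLeast_hitSet (hb : IsAdmissibleField b) (hS : IsClosed S) {x : E d}
    (h : arrivalTime b S x ≠ ⊤) : ∃ t, IsLeast (hitSet b S x) t := by
  have hne : (hitSet b S x).Nonempty := by
    by_contra hcon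
    refine h ?_
    rw [not_nonempty_iff_eq_empty] at hcon
    change sInf ((fun t : ℝ => (t : EReal)) '' hitSet b S x) = ⊤
    rw [hcon, image_empty, sInf_empty]
  have hbdd : BddBelow (hitSet b S x) := ⟨0, fun t ht => ht.1⟩
  have hclosed : IsClosed (hitSet b S x) :=
    isClosed_Ici.inter (hS.preimage (hb.continuous_flow_zero.comp
      (continuous_const.prodMk continuous_id)))
  exact ⟨_, hclosed.isLeast_csInf hne hbdd⟩

theorem arrivalTime_eq_coe_iff (hb : IsAdmissibleField b) (hS : IsClosed S) {x : E d} {t : ℝ} :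
    arrivalTime b S x = t ↔ IsLeast (hitSet b S x) t := by
  refine ⟨fun h => ?_, arrivalTime_eq_of_isLeast⟩
  obtain ⟨r, hr⟩ := exists_isLeast_hitSet hb hS (h ▸ EReal.coe_ne_top t)
  have : (r : EReal) = t := (arrivalTime_eq_of_isLeast hr).symm.trans h
  rwa [← EReal.coe_injective this]

/-- As the arrival time is attained, `B(s)` consists of the points whose trajectory meets the sink
between the times `0` and `s`. -/
theorem mem_reachSet_iff (hb : IsAdmissibleField b) (hS : IsClosed S) {x : E d} {s : ℝ} :
    x ∈ reachSet b S s ↔ ∃ t ∈ Icc 0 s, flow b x 0 t ∈ S := by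
  constructor
  · intro h
    have h' : arrivalTime b S x ≤ s := h
    obtain ⟨t, ht⟩ := exists_isLeast_hitSet hb hS (h'.trans_lt (EReal.coe_lt_top s)).ne
    rw [arrivalTime_eq_of_isLeast ht] at h'
    exact ⟨t, ⟨ht.1.1, by exact_mod_cast h'⟩, ht.1.2⟩
  · rintro ⟨t, ht, hts⟩
    have h1 : arrivalTime b S x ≤ t := sInf_le ⟨t, ⟨ht.1, hts⟩, rfl⟩
    exact h1.trans (by exact_mod_cast ht.2)

theorem reachSet_mono {s t : ℝ} (h : s ≤ t) : reachSet b S s ⊆ reachSet b S t :=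
  fun _ hx => le_trans (α := EReal) hx (by exact_mod_cast h)

theorem reachSet_zero (hb : IsAdmissibleField b) (hS : IsClosed S) : reachSet b S 0 = S := by
  ext x
  rw [mem_reachSet_iff hb hS]
  simp [hb.flow_self]

/-- `B(s)` is the projection of a closed set along the compact interval `[0, s]`. -/
theorem isClosed_reachSet (hb : IsAdmissibleField b) (hS : IsClosed S) (s : ℝ) :
    IsClosed (reachSet b S s) := by
  have hK : IsClosed {p : Icc 0 s × E d | flow b p.2 0 p.1 ∈ S} :=
    hS.preimage (hb.continuous_flow_zero.comp
      (continuous_snd.prodMk (continuous_subtype_val.comp continuous_fst)))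
  convert isClosedMap_snd_of_compactSpace _ hK using 1
  ext x
  rw [mem_reachSet_iff hb hS]
  constructor
  · rintro ⟨t, ht, hts⟩
    exact ⟨(⟨t, ht⟩, x), hts, rfl⟩
  · rintro ⟨p, hp, rfl⟩
    exact ⟨p.1, p.1.2, hp⟩

theorem measurable_arrivalTime (hb : IsAdmissibleField b) (hS : IsClosed S) :
    Measurable (arrivalTime b S) := by
  refine measurable_of_Iic fun a => ?_
  induction a with
  | bot =>
    convert MeasurableSet.empty
    ext x
    simpa using ((EReal.bot_lt_zero).trans_le (arrivalTime_nonneg x)).ne'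
  | top => simp
  | coe s => exact (isClosed_reachSet hb hS s).measurableSet

theorem measurable_arrivalMap (hb : IsAdmissibleField b) (hS : IsClosed S) :
    Measurable (arrivalMap b S) :=
  measurable_ereal_toReal.comp (measurable_arrivalTime hb hS)

/-- On `B(s)` the real-valued map `π` is the arrival time. -/
theorem coe_arrivalMap {x : E d} {s : ℝ} (hx : x ∈ reachSet b S s) :
    (arrivalMap b S x : EReal) = arrivalTime b S x :=
  EReal.coe_toReal (lt_of_le_of_lt (α := EReal) hx (EReal.coe_lt_top s)).ne
    ((EReal.bot_lt_zero).trans_le (arrivalTime_nonneg x)).ne'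

theorem arrivalMap_nonneg (x : E d) : 0 ≤ arrivalMap b S x :=
  EReal.toReal_nonneg (arrivalTime_nonneg x)

theorem arrivalMap_eq_of_mem_reachFiber {x : E d} {τ : ℝ} (hx : x ∈ reachFiber b S τ) :
    arrivalMap b S x = τ := by
  have h : arrivalTime b S x = τ := hx
  rw [arrivalMap, h, EReal.toReal_coe]

theorem mem_reachFiber_arrivalMap {x : E d} {s : ℝ} (hx : x ∈ reachSet b S s) :
    x ∈ reachFiber b S (arrivalMap b S x) :=
  (coe_arrivalMap hx).symm

/-- Among the points of `B(s)`, those of `B(t)` are selected by `π ≤ t`. -/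
theorem mem_reachSet_iff_arrivalMap_le {x : E d} {s t : ℝ} (hx : x ∈ reachSet b S s) :
    x ∈ reachSet b S t ↔ arrivalMap b S x ≤ t := by
  change arrivalTime b S x ≤ t ↔ _
  rw [← coe_arrivalMap hx, EReal.coe_le_coe_iff]

theorem measurableSet_graph_arrivalTime (hb : IsAdmissibleField b) (hS : IsClosed S) :
    MeasurableSet {p : ℝ × E d | p.2 ∈ reachFiber b S p.1} :=
  measurableSet_eq_fun ((measurable_arrivalTime hb hS).comp measurable_snd)
    (measurable_coe_real_ereal.comp measurable_fst)

theorem measurableSet_graph_reachSet (hb : IsAdmissibleField b) (hS : IsClosed S) :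
    MeasurableSet {p : E d × ℝ | p.1 ∈ reachSet b S p.2} :=
  measurableSet_le ((measurable_arrivalTime hb hS).comp measurable_fst)
    (measurable_coe_real_ereal.comp measurable_snd)

/-- A trajectory that starts outside the sink enters it through the boundary. -/
theorem flow_mem_frontier (hb : IsAdmissibleField b) (hS : IsClosed S) {x : E d} {τ : ℝ}
    (hτ : 0 < τ) (hx : x ∈ reachFiber b S τ) : flow b x 0 τ ∈ frontier S := by
  have hl := (arrivalTime_eq_coe_iff hb hS).1 hx
  refine ⟨subset_closure hl.1.2, fun hint => ?_⟩
  have hcont : Continuous fun s => flow b x 0 s :=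
    hb.continuous_flow_zero.comp (continuous_const.prodMk continuous_id)
  have h1 : ∀ᶠ s in 𝓝[<] τ, flow b x 0 s ∈ S :=
    (hcont.continuousAt.continuousWithinAt.eventually (isOpen_interior.mem_nhds hint)).mono
      fun s hs => interior_subset hs
  have h2 : ∀ᶠ s in 𝓝[<] τ, s ∈ Ioo 0 τ := Ioo_mem_nhdsLT hτ
  obtain ⟨s, hs1, hs2⟩ := (h1.and h2).exists
  exact absurd (hl.2 ⟨hs2.1.le, hs1⟩) (not_le.2 hs2.2)

/-- By invertibility of the flow, `Φ(B(s), 0, s)` pulls back to `B(s)`. -/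
theorem preimage_removedSet (hb : IsAdmissibleField b) (s : ℝ) :
    (fun x => flow b x 0 s) ⁻¹' removedSet b S s = reachSet b S s :=
  preimage_image_eq _ (hb.flow_injective 0 s)

theorem measurableSet_removedSet (hb : IsAdmissibleField b) (hS : IsClosed S) (s : ℝ) :
    MeasurableSet (removedSet b S s) := by
  have : removedSet b S s = (fun z => flow b z s 0) ⁻¹' reachSet b S s :=
    congrFun (image_eq_preimage_of_inverse (fun x => hb.flow_inverse x 0 s)
      (fun z => hb.flow_inverse z s 0)) _
  rw [this]
  exact ((isClosed_reachSet hb hS s).preimage (hb.continuous_flow_left s 0)).measurableSet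

/-! ### Absolute continuity of the law of the arrival time -/

/-- Lipschitz maps between spaces of the same finite dimension send Lebesgue null sets to Lebesgue
null sets; seen through Haar measures, which are multiples of the Hausdorff measure. -/
theorem addHaar_image_eq_zero_of_lipschitzOnWith {X Y : Type*}
    [NormedAddCommGroup X] [NormedSpace ℝ X] [FiniteDimensional ℝ X] [MeasurableSpace X]
    [BorelSpace X] [NormedAddCommGroup Y] [NormedSpace ℝ Y] [FiniteDimensional ℝ Y]
    [MeasurableSpace Y] [BorelSpace Y] (hdim : Module.finrank ℝ X = Module.finrank ℝ Y)
    (μ : Measure X) [μ.IsAddHaarMeasure] (ν : Measure Y) [ν.IsAddHaarMeasure]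
    {f : X → Y} {s : Set X} {K : ℝ≥0} (hf : LipschitzOnWith K f s) (hs : μ s = 0) :
    ν (f '' s) = 0 := by
  have h1 : μH[(Module.finrank ℝ X : ℝ)] s = 0 :=
    Measure.absolutelyContinuous_isAddHaarMeasure _ μ hs
  have h2 : μH[(Module.finrank ℝ Y : ℝ)] (f '' s) = 0 := by
    rw [← hdim]
    refine le_antisymm ((hf.hausdorffMeasure_image_le (by positivity)).trans ?_) zero_le
    rw [h1, mul_zero]
  exact Measure.absolutelyContinuous_isAddHaarMeasure ν _ h2

/-- A level set of a function with nonvanishing strict derivative at `z` is, near `z`, a Lipschitz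
image of a piece of the kernel of the derivative. -/
theorem exists_lipschitz_parametrization_levelSet {X : Type*} [NormedAddCommGroup X]
    [NormedSpace ℝ X] [CompleteSpace X] {f : X → ℝ} {f' : X →L[ℝ] ℝ} {z : X}
    (hf : HasStrictFDerivAt f f' z) (hf' : f' ≠ 0) :
    ∃ V ∈ 𝓝 z, ∃ (W : Set f'.ker) (ψ : f'.ker → X) (K : ℝ≥0), LipschitzOnWith K ψ W ∧
      V ∩ {x | f x = f z} ⊆ ψ '' W := by
  have hrange : f'.range = ⊤ :=
    LinearMap.range_eq_top.2 (LinearMap.surjective (f := f'.toLinearMap)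
      fun h => hf' (ContinuousLinearMap.coe_injective h))
  obtain ⟨K, W, hW, hψ⟩ := (hf.to_implicitFunction hrange).exists_lipschitzOnWith
  set h := hf.implicitToOpenPartialHomeomorph f f' hrange with hdef
  have hcont : Tendsto (fun x => (h x).2) (𝓝 z) (𝓝 0) := by
    have := (h.continuousAt (hf.mem_implicitToOpenPartialHomeomorph_source hrange)).snd
    rwa [ContinuousAt, hf.implicitToOpenPartialHomeomorph_self hrange] at this
  refine ⟨_, inter_mem (hf.eq_implicitFunction hrange) (hcont hW), W, _, K, hψ, ?_⟩
  rintro x ⟨⟨hx1, hx2⟩, hx3⟩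
  have hx1' : hf.implicitFunction f f' hrange (f x) (h x).2 = x := hx1
  have hx3' : f x = f z := hx3
  exact ⟨(h x).2, hx2, by rw [← hx3', hx1']⟩

/-- A Lipschitz function of a time in a null set and of a parameter in a space of one dimension less
covers a null set. -/
theorem volume_image_prod_eq_zero {k X : Type*} [NormedAddCommGroup k] [NormedSpace ℝ k]
    [FiniteDimensional ℝ k] [PseudoMetricSpace X]
    (hdim : Module.finrank ℝ (ℝ × k) = Module.finrank ℝ (E d)) {W : Set k} {ψ : k → X}
    {K C : ℝ≥0} (hψ : LipschitzOnWith K ψ W) {N : Set ℝ} (hN : volume N = 0) {F : ℝ × X → E d}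
    (hF : LipschitzOnWith C F (N ×ˢ univ)) :
    volume (F '' (N ×ˢ (ψ '' W))) = 0 := by
  borelize k
  let μ : Measure (ℝ × k) := (volume : Measure ℝ).prod μH[(Module.finrank ℝ k : ℝ)]
  have hnull : μ (N ×ˢ W) = 0 := by
    rw [Measure.prod_prod, hN, zero_mul]
  have hΨ : LipschitzOnWith (max 1 K) (fun p : ℝ × k => (p.1, ψ p.2)) (N ×ˢ W) := by
    refine LipschitzOnWith.of_dist_le_mul fun p hp q hq => ?_
    rw [Prod.dist_eq]
    refine max_le ?_ ?_
    · calc dist p.1 q.1 ≤ (1 : ℝ≥0) * dist p q := by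
            rw [NNReal.coe_one, one_mul, Prod.dist_eq]; exact le_max_left _ _
        _ ≤ _ := by gcongr; exact le_max_left _ _
    · calc dist (ψ p.2) (ψ q.2) ≤ K * dist p.2 q.2 := hψ.dist_le_mul _ hp.2 _ hq.2
        _ ≤ _ := by
          gcongr
          · exact le_max_right _ _
          · rw [Prod.dist_eq]; exact le_max_right _ _
  have hcomp : LipschitzOnWith (C * max 1 K) (F ∘ fun p : ℝ × k => (p.1, ψ p.2)) (N ×ˢ W) :=
    hF.comp hΨ fun p hp => ⟨hp.1, mem_univ _⟩
  refine measure_mono_null ?_ (addHaar_image_eq_zero_of_lipschitzOnWith hdim μ volume hcomp hnull)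
  rintro _ ⟨⟨t, _⟩, ⟨ht, w, hw, rfl⟩, rfl⟩
  exact ⟨(t, w), ⟨ht, hw⟩, rfl⟩

/-- A Lipschitz function of a time in a null set and of a point of a hypersurface covers a null
set: in a chart it is a Lipschitz function of `d` real variables, one of which stays in a null
set. -/
theorem exists_nhds_volume_image_levelSet_eq_zero {f : E d → ℝ} {z : E d}
    (hf : ContDiffAt ℝ 1 f z) (hf' : fderiv ℝ f z ≠ 0) :
    ∃ V ∈ 𝓝 z, ∀ (N : Set ℝ) (F : ℝ × E d → E d) (C : ℝ≥0), volume N = 0 →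
      LipschitzOnWith C F (N ×ˢ univ) →
      volume (F '' (N ×ˢ (V ∩ {x | f x = f z}))) = 0 := by
  obtain ⟨V, hV, W, ψ, K, hψ, hsub⟩ :=
    exists_lipschitz_parametrization_levelSet (hf.hasStrictFDerivAt one_ne_zero) hf'
  refine ⟨V, hV, fun N F C hN hF => ?_⟩
  have hdim : Module.finrank ℝ (ℝ × (fderiv ℝ f z).ker) = Module.finrank ℝ (E d) := by
    -- Rank–nullity: the kernel of a nonzero linear form has dimension `d - 1`.
    have h1 := LinearMap.finrank_range_add_finrank_ker (fderiv ℝ f z).toLinearMap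
    have h2 : LinearMap.range (fderiv ℝ f z).toLinearMap = ⊤ :=
      LinearMap.range_eq_top.2 (LinearMap.surjective
        fun h => hf' (ContinuousLinearMap.coe_injective h))
    rw [h2, finrank_top] at h1
    rw [Module.finrank_prod, ← h1]
  exact measure_mono_null (image_mono (prod_mono le_rfl hsub))
    (volume_image_prod_eq_zero hdim hψ hN hF)

/-- Points that reach the sink at a positive time of a null set form a null set: they are recovered
from the arrival time and the arrival point, which lies on a compact hypersurface, by following the
flow backwards. -/
theorem volume_reachFiber_eq_zero (hb : IsAdmissibleField b) (hS : IsAdmissibleSink S) {T : ℝ}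
    {N : Set ℝ} (hN : volume N = 0) (hNT : N ⊆ Ioc 0 T) :
    volume {x | ∃ τ ∈ N, x ∈ reachFiber b S τ} = 0 := by
  obtain ⟨M, L, hM, hflow⟩ := hb.exists_dist_flow_le
  let F : ℝ × E d → E d := fun p => flow b p.2 p.1 0
  have hF : LipschitzOnWith (NNReal.mk ((1 + M) * Real.exp (L * T)) (by positivity)) F
      (N ×ˢ univ) := by
    refine LipschitzOnWith.of_dist_le_mul fun p hp q hq => ?_
    have h := hflow p.2 q.2 p.1 q.1 0 0
    have hp1 := hNT hp.1
    have h1 : |0 - p.1| ≤ T := by rw [zero_sub, abs_neg, abs_of_pos hp1.1]; exact hp1.2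
    have h2 : dist p.2 q.2 ≤ dist p q := by rw [Prod.dist_eq]; exact le_max_right _ _
    have h3 : |p.1 - q.1| ≤ dist p q := by
      rw [Prod.dist_eq, ← Real.dist_eq]; exact le_max_left _ _
    calc dist (F p) (F q)
        ≤ (dist p.2 q.2 + M * |p.1 - q.1|) * Real.exp (L * |0 - p.1|) := by simpa using h
      _ ≤ (dist p q + M * dist p q) * Real.exp (L * T) := by gcongr
      _ = _ := by rw [NNReal.coe_mk]; ring
  -- Each boundary point has a neighbourhood whose contribution is null; compactness of the
  -- boundary leaves finitely many of them.
  have hlocal : ∀ z ∈ frontier S, ∃ V ∈ 𝓝 z, volume (F '' (N ×ˢ (V ∩ frontier S))) = 0 := by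
    intro z hz
    obtain ⟨U, hU, hzU, f, hf, hf', hfz⟩ := hS.c1Boundary z hz
    obtain ⟨V, hV, hV'⟩ := exists_nhds_volume_image_levelSet_eq_zero
      (hf.contDiffAt (hU.mem_nhds hzU)) hf'
    have hmem : ∀ x ∈ frontier S ∩ U, f x = 0 := fun x hx => (hfz ▸ hx : x ∈ {x ∈ U | f x = 0}).2
    refine ⟨V ∩ U, inter_mem hV (hU.mem_nhds hzU), measure_mono_null ?_ (hV' N F _ hN hF)⟩
    refine image_mono (prod_mono le_rfl ?_)
    rintro x ⟨⟨hxV, hxU⟩, hx⟩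
    exact ⟨hxV, (hmem x ⟨hx, hxU⟩).trans (hmem z ⟨hz, hzU⟩).symm⟩
  choose! V hV hV0 using hlocal
  obtain ⟨I, hI, hcover⟩ := hS.isCompact_frontier.elim_nhds_subcover V hV
  refine measure_mono_null ?_
    ((measure_biUnion_null_iff I.countable_toSet).2 fun z hz => hV0 z (hI z hz))
  rintro x ⟨τ, hτ, hx⟩
  have hfr := flow_mem_frontier hb hS.isClosed (hNT hτ).1 hx
  obtain ⟨z, hz, hzV⟩ := mem_iUnion₂.1 (hcover hfr)
  exact mem_iUnion₂.2 ⟨z, hz, (τ, flow b x 0 τ), ⟨hτ, hzV, hfr⟩, hb.flow_inverse x 0 τ⟩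

/-- The law of the arrival time under a measure that does not charge the sink and is absolutely
continuous is itself absolutely continuous. -/
theorem arrivalLaw_absolutelyContinuous (hb : IsAdmissibleField b) (hS : IsAdmissibleSink S)
    {T : ℝ} {m : Measure (E d)} (hm : m ≪ volume) (hmS : m S = 0) :
    arrivalLaw b S T m ≪ volume.restrict (Icc 0 T) := by
  have hπ := measurable_arrivalMap hb hS.isClosed
  have hBT := (isClosed_reachSet hb hS.isClosed T).measurableSet
  refine Measure.AbsolutelyContinuous.mk fun N hN hN0 => ?_
  rw [arrivalLaw, Measure.map_apply hπ hN, Measure.restrict_apply (hπ hN)]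
  rw [Measure.restrict_apply hN] at hN0
  have hnull := volume_reachFiber_eq_zero hb hS (N := N ∩ Ioc 0 T) (T := T)
    (measure_mono_null (by gcongr; exact Ioc_subset_Icc_self) hN0) inter_subset_right
  refine measure_mono_null ?_ (measure_union_null hmS (hm hnull))
  rintro x ⟨hxN, hxT⟩
  -- The points with arrival time `0` form the sink itself, which carries no mass.
  rcases (arrivalMap_nonneg (b := b) (S := S) x).eq_or_lt with h0 | h0
  · left
    rw [← reachSet_zero hb hS.isClosed]
    exact (mem_reachSet_iff_arrivalMap_le hxT).2 h0.symm.le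
  · right
    exact ⟨_, ⟨hxN, h0, (mem_reachSet_iff_arrivalMap_le hxT).1 hxT⟩,
      mem_reachFiber_arrivalMap hxT⟩

/-! ### Disintegration along the fibers of the arrival time -/

/-- The joint law of the arrival time and of the starting point, on `B(T)`. -/
noncomputable def arrivalJointLaw (b : E d → ℝ → E d) (S : Set (E d)) (T : ℝ) (m : Measure (E d)) :
    Measure (ℝ × E d) :=
  (m.restrict (reachSet b S T)).map fun x => (arrivalMap b S x, x)

theorem measurable_arrivalMap_prodMk (hb : IsAdmissibleField b) (hS : IsClosed S) :
    Measurable fun x => (arrivalMap b S x, x) :=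
  (measurable_arrivalMap hb hS).prodMk measurable_id

instance instIsFiniteMeasureArrivalLaw (b : E d → ℝ → E d) (S : Set (E d)) (T : ℝ)
    (m : Measure (E d)) [IsFiniteMeasure m] : IsFiniteMeasure (arrivalLaw b S T m) :=
  inferInstanceAs (IsFiniteMeasure (Measure.map _ _))

instance instIsFiniteMeasureArrivalJointLaw (b : E d → ℝ → E d) (S : Set (E d)) (T : ℝ)
    (m : Measure (E d)) [IsFiniteMeasure m] : IsFiniteMeasure (arrivalJointLaw b S T m) :=
  inferInstanceAs (IsFiniteMeasure (Measure.map _ _))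

theorem fst_arrivalJointLaw (hb : IsAdmissibleField b) (hS : IsClosed S) (T : ℝ)
    (m : Measure (E d)) : (arrivalJointLaw b S T m).fst = arrivalLaw b S T m := by
  rw [Measure.fst, arrivalJointLaw, arrivalLaw,
    Measure.map_map measurable_fst (measurable_arrivalMap_prodMk hb hS)]
  rfl

/-- A kernel disintegrating the joint law of `(t_x, x)` is concentrated on the fibers, because the
joint law is concentrated on the graph of the arrival time. -/
theorem ae_ae_mem_reachFiber (hb : IsAdmissibleField b) (hS : IsClosed S) {T : ℝ}
    {m : Measure (E d)} [IsFiniteMeasure m] {κ : ProbabilityTheory.Kernel ℝ (E d)}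
    [ProbabilityTheory.IsMarkovKernel κ]
    (hκ : arrivalLaw b S T m ⊗ₘ κ = arrivalJointLaw b S T m) :
    ∀ᵐ τ ∂(arrivalLaw b S T m), ∀ᵐ x ∂(κ τ), x ∈ reachFiber b S τ := by
  refine Measure.ae_ae_of_ae_compProd (p := fun p : ℝ × E d => p.2 ∈ reachFiber b S p.1) ?_
  rw [hκ]
  refine (ae_map_iff (measurable_arrivalMap_prodMk hb hS).aemeasurable
    (measurableSet_graph_arrivalTime hb hS)).2 ?_
  filter_upwards [ae_restrict_mem (isClosed_reachSet hb hS T).measurableSet] with x hx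
  exact mem_reachFiber_arrivalMap hx

theorem measure_eq_lintegral_arrivalLaw (hb : IsAdmissibleField b) (hS : IsClosed S) {T : ℝ}
    {m : Measure (E d)} [IsFiniteMeasure m] {κ : ProbabilityTheory.Kernel ℝ (E d)}
    [ProbabilityTheory.IsMarkovKernel κ]
    (hκ : arrivalLaw b S T m ⊗ₘ κ = arrivalJointLaw b S T m) {t : ℝ} (ht : t ≤ T)
    {A : Set (E d)} (hA : MeasurableSet A) (hAt : A ⊆ reachSet b S t) :
    m A = ∫⁻ τ in Icc 0 t, κ τ (reachFiber b S τ ∩ A) ∂(arrivalLaw b S T m) := by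
  have h1 : ∫⁻ τ in Icc 0 t, κ τ (reachFiber b S τ ∩ A) ∂(arrivalLaw b S T m)
      = ∫⁻ τ in Icc 0 t, κ τ A ∂(arrivalLaw b S T m) := by
    refine lintegral_congr_ae (ae_restrict_of_ae ?_)
    filter_upwards [ae_ae_mem_reachFiber hb hS hκ] with τ hτ
    refine measure_congr ?_
    filter_upwards [hτ] with x hx
    exact propext ⟨fun h => h.2, fun h => ⟨hx, h⟩⟩
  rw [h1, ← Measure.compProd_apply_prod measurableSet_Icc hA, hκ, arrivalJointLaw,
    Measure.map_apply (measurable_arrivalMap_prodMk hb hS)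
      (measurableSet_Icc.prod hA),
    Measure.restrict_apply ((measurable_arrivalMap_prodMk hb hS)
      (measurableSet_Icc.prod hA))]
  congr 1
  ext x
  constructor
  · exact fun hx => ⟨⟨⟨arrivalMap_nonneg x, (mem_reachSet_iff_arrivalMap_le (hAt hx)).1 (hAt hx)⟩,
      hx⟩, reachSet_mono ht (hAt hx)⟩
  · exact fun hx => hx.1.2

/-- The conditional law of the starting point given the arrival time disintegrates the measure, and
absolute continuity of the law of the arrival time provides the density. -/
theorem exists_isArrivalDisintegration (hb : IsAdmissibleField b) (hS : IsAdmissibleSink S) (T : ℝ)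
    {m : Measure (E d)} [IsFiniteMeasure m] (hm : m ≪ volume) (hmS : m S = 0) :
    ∃ (κ : ProbabilityTheory.Kernel ℝ (E d)) (g : ℝ → ℝ≥0),
      IsArrivalDisintegration b S T m κ g ∧
        arrivalLaw b S T m ⊗ₘ κ = arrivalJointLaw b S T m := by
  set ν := arrivalLaw b S T m with hν
  set κ := (arrivalJointLaw b S T m).condKernel with hκdef
  have hκ : ν ⊗ₘ κ = arrivalJointLaw b S T m := by
    rw [hν, ← fst_arrivalJointLaw hb hS.isClosed]
    exact (arrivalJointLaw b S T m).disintegrate _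
  have hac : ν ≪ volume.restrict (Icc 0 T) := arrivalLaw_absolutelyContinuous hb hS hm hmS
  set g : ℝ → ℝ≥0 := fun τ => (ν.rnDeriv (volume.restrict (Icc 0 T)) τ).toNNReal with hg
  have hgm : Measurable g := (Measure.measurable_rnDeriv _ _).ennreal_toNNReal
  have hlaw : ν = (volume.restrict (Icc 0 T)).withDensity fun τ => (g τ : ℝ≥0∞) := by
    conv_lhs => rw [← Measure.withDensity_rnDeriv_eq _ _ hac]
    refine withDensity_congr_ae ?_
    filter_upwards [Measure.rnDeriv_lt_top ν (volume.restrict (Icc 0 T))] with τ hτ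
    exact (ENNReal.coe_toNNReal hτ.ne).symm
  refine ⟨κ, g, ⟨inferInstance, hgm, hlaw, fun t ht A hA hAt =>
    measure_eq_lintegral_arrivalLaw hb hS.isClosed hκ ht.2 hA hAt, fun t ht A hA hAt => ?_⟩, hκ⟩
  have hmeas : Measurable fun τ => κ τ (reachFiber b S τ ∩ A) :=
    ProbabilityTheory.Kernel.measurable_kernel_prodMk_left
      (t := {p : ℝ × E d | p.2 ∈ reachFiber b S p.1} ∩ Prod.snd ⁻¹' A)
      ((measurableSet_graph_arrivalTime hb hS.isClosed).inter (measurable_snd hA))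
  rw [measure_eq_lintegral_arrivalLaw hb hS.isClosed hκ ht.2 hA hAt, ← hν, hlaw,
    restrict_withDensity measurableSet_Icc,
    lintegral_withDensity_eq_lintegral_mul _ hgm.coe_nnreal_ennreal hmeas,
    Measure.restrict_restrict measurableSet_Icc,
    inter_eq_self_of_subset_left (Icc_subset_Icc_right ht.2)]
  rfl

/-! ### The candidate as a path in the space of measures -/

/-- No mass arrives at the sink at a single instant. -/
theorem measure_reachFiber_eq_zero (hb : IsAdmissibleField b) (hS : IsAdmissibleSink S)
    {m : Measure (E d)} (hm : m ≪ volume) (hmS : m S = 0) (t : ℝ) :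
    m (reachFiber b S t) = 0 := by
  rcases le_or_gt t 0 with ht | ht
  · refine measure_mono_null (fun x hx => ?_) hmS
    have h0 : x ∈ reachSet b S 0 := reachSet_mono ht (le_of_eq (α := EReal) hx)
    rwa [reachSet_zero hb hS.isClosed] at h0
  · have := volume_reachFiber_eq_zero hb hS (N := {t}) (T := t) (by simp) (by simpa using ht)
    refine measure_mono_null ?_ (hm this)
    exact fun x hx => ⟨t, rfl, hx⟩

theorem initialMeasure_le (S : Set (E d)) (m₀ : Measure (E d)) : initialMeasure S m₀ ≤ m₀ :=
  Measure.restrict_le_self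

instance instIsFiniteMeasureInitialMeasure (S : Set (E d)) (m₀ : Measure (E d))
    [IsFiniteMeasure m₀] : IsFiniteMeasure (initialMeasure S m₀) :=
  inferInstanceAs (IsFiniteMeasure (m₀.restrict Sᶜ))

theorem mem_massSet_of_le {G : ℝ≥0} {μ ν : Measure (E d)} (h : μ ≤ ν) (hν : ν ∈ massSet d G) :
    μ ∈ massSet d G :=
  ⟨(h univ).trans hν.1, (lintegral_mono' h le_rfl).trans_lt hν.2⟩

theorem isFiniteMeasure_of_mem_massSet {G : ℝ≥0} {μ : Measure (E d)} (h : μ ∈ massSet d G) :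
    IsFiniteMeasure μ :=
  ⟨h.1.trans_lt ENNReal.coe_lt_top⟩

theorem initialMeasure_sink (hS : IsClosed S) (m₀ : Measure (E d)) :
    initialMeasure S m₀ S = 0 := by
  rw [initialMeasure, Measure.restrict_apply hS.measurableSet, inter_compl_self, measure_empty]

/-- The candidate is the image by the flow of the part of the initial datum that has not met the
sink. -/
theorem sinkPath_eq_map (hb : IsAdmissibleField b) (hS : IsClosed S) (m₀ : Measure (E d)) (s : ℝ) :
    sinkPath b S m₀ s =
      ((initialMeasure S m₀).restrict (reachSet b S s)ᶜ).map fun x => flow b x 0 s := by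
  rw [sinkPath, Measure.restrict_map (hb.continuous_flow_left 0 s).measurable
    (measurableSet_removedSet hb hS s).compl, preimage_compl, preimage_removedSet hb]

theorem sinkPath_zero (hb : IsAdmissibleField b) (hS : IsClosed S) (m₀ : Measure (E d)) :
    sinkPath b S m₀ 0 = initialMeasure S m₀ := by
  have hid : (fun x => flow b x 0 0) = id := funext fun x => hb.flow_self x 0
  rw [sinkPath_eq_map hb hS, hid, Measure.map_id, reachSet_zero hb hS, initialMeasure,
    Measure.restrict_restrict hS.measurableSet.compl, inter_self]

theorem map_flow_mem_massSet (hb : IsAdmissibleField b) {G : ℝ≥0} {m : Measure (E d)}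
    (hm : m ∈ massSet d G) (s : ℝ) : (m.map fun x => flow b x 0 s) ∈ massSet d G := by
  have hmeas := (hb.continuous_flow_left 0 s).measurable
  have := isFiniteMeasure_of_mem_massSet hm
  refine ⟨by rw [Measure.map_apply hmeas MeasurableSet.univ]; exact hm.1, ?_⟩
  rw [lintegral_map (by fun_prop) hmeas]
  obtain ⟨M, hM⟩ := hb.bounded
  have hbound : ∀ x, (‖flow b x 0 s‖₊ : ℝ≥0∞) ≤ ‖x‖₊ + ENNReal.ofReal (M * |s|) := by
    intro x
    have h1 := dist_trajectory_time_le hM (hb.hasDerivAt_flow x 0) s 0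
    rw [hb.flow_self, sub_zero, dist_eq_norm] at h1
    have h2 : ‖flow b x 0 s‖ ≤ ‖x‖ + M * |s| := by
      linarith [norm_sub_norm_le (flow b x 0 s) x]
    have h3 := ENNReal.ofReal_le_ofReal h2
    rw [ENNReal.ofReal_add (norm_nonneg _) ((norm_nonneg _).trans h1)] at h3
    simp only [ofReal_norm] at h3
    exact h3
  refine (lintegral_mono hbound).trans_lt ?_
  rw [lintegral_add_right _ measurable_const, lintegral_const]
  exact ENNReal.add_lt_top.2 ⟨hm.2, ENNReal.mul_lt_top ENNReal.ofReal_lt_top (measure_lt_top m _)⟩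

theorem sinkPath_mem_massSet (hb : IsAdmissibleField b) {G : ℝ≥0} {m₀ : Measure (E d)}
    (hm₀ : m₀ ∈ massSet d G) (s : ℝ) : sinkPath b S m₀ s ∈ massSet d G :=
  mem_massSet_of_le Measure.restrict_le_self
    (map_flow_mem_massSet hb (mem_massSet_of_le (initialMeasure_le S m₀) hm₀) s)

theorem integral_sinkPath (hb : IsAdmissibleField b) (hS : IsClosed S) (m₀ : Measure (E d)) (s : ℝ)
    {φ : E d → ℝ} (hφ : StronglyMeasurable φ) :
    ∫ x, φ x ∂(sinkPath b S m₀ s) =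
      ∫ x, (reachSet b S s)ᶜ.indicator (fun x => φ (flow b x 0 s)) x ∂(initialMeasure S m₀) := by
  rw [sinkPath_eq_map hb hS, integral_map (hb.continuous_flow_left 0 s).aemeasurable
    hφ.aestronglyMeasurable,
    integral_indicator (isClosed_reachSet hb hS s).measurableSet.compl]

/-- Two positions on the same trajectory contribute their distance to the generalized Wasserstein
distance, unless exactly one of them has been removed, where the bound `|φ| ≤ 1` is used. -/
theorem wasserstein_sinkPath_le (hb : IsAdmissibleField b) (hS : IsClosed S) {M : ℝ}
    (hM : ∀ x t, ‖b x t‖ ≤ M) {m₀ : Measure (E d)} [IsFiniteMeasure m₀] (s t : ℝ) :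
    wasserstein (sinkPath b S m₀ s) (sinkPath b S m₀ t) ≤
      ENNReal.ofReal (∫ x, (M * |s - t| + |(reachSet b S s).indicator (fun _ => (1 : ℝ)) x -
        (reachSet b S t).indicator (fun _ => (1 : ℝ)) x|) ∂(initialMeasure S m₀)) := by
  have hmeas : ∀ r, MeasurableSet (reachSet b S r) := fun r =>
    (isClosed_reachSet hb hS r).measurableSet
  refine iSup₂_le fun φ hφ => ENNReal.ofReal_le_ofReal ?_
  obtain ⟨hφc, -, hφ1, hφL⟩ := hφ
  have hint : ∀ r, Integrable ((reachSet b S r)ᶜ.indicator fun x => φ (flow b x 0 r))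
      (initialMeasure S m₀) := fun r =>
    (Integrable.of_bound (hφc.comp (hb.continuous_flow_left 0 r)).aestronglyMeasurable 1
      (Eventually.of_forall fun x => hφ1 _)).indicator (hmeas r).compl
  have hind : ∀ r, Integrable ((reachSet b S r).indicator fun _ => (1 : ℝ))
      (initialMeasure S m₀) := fun r => (integrable_const 1).indicator (hmeas r)
  rw [integral_sinkPath hb hS m₀ s hφc.stronglyMeasurable,
    integral_sinkPath hb hS m₀ t hφc.stronglyMeasurable, ← integral_sub (hint s) (hint t)]
  refine integral_mono ((hint s).sub (hint t))
    ((integrable_const _).add ((hind s).sub (hind t)).abs) fun x => ?_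
  have hdist : |φ (flow b x 0 s) - φ (flow b x 0 t)| ≤ M * |s - t| := by
    have h := hφL.dist_le_mul (flow b x 0 s) (flow b x 0 t)
    rw [NNReal.coe_one, one_mul, Real.dist_eq] at h
    exact h.trans (dist_trajectory_time_le hM (hb.hasDerivAt_flow x 0) s t)
  have hpos : 0 ≤ M * |s - t| := (abs_nonneg _).trans hdist
  have hs1 := abs_le.1 (hφ1 (flow b x 0 s))
  have ht1 := abs_le.1 (hφ1 (flow b x 0 t))
  have hd := (le_abs_self _).trans hdist
  by_cases hxs : x ∈ reachSet b S s <;> by_cases hxt : x ∈ reachSet b S t <;>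
    simp [hxs, hxt] <;> linarith

/-- Off the fiber `B^t`, the sets `B(s)` are eventually constant as `s → t`. -/
theorem eventually_mem_reachSet_iff {x : E d} {t : ℝ} (hx : x ∉ reachFiber b S t) :
    ∀ᶠ s in 𝓝 t, (x ∈ reachSet b S s ↔ x ∈ reachSet b S t) := by
  have hcont : Tendsto (fun s : ℝ => (s : EReal)) (𝓝 t) (𝓝 (t : EReal)) :=
    continuous_coe_real_ereal.tendsto t
  rcases lt_or_gt_of_ne (show arrivalTime b S x ≠ t from hx) with h | h
  · filter_upwards [hcont.eventually (lt_mem_nhds h)] with s hs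
    exact iff_of_true hs.le h.le
  · filter_upwards [hcont.eventually (gt_mem_nhds h)] with s hs
    exact iff_of_false hs.not_ge h.not_ge

/-- Continuity in time: by dominated convergence, since almost every point lies off the fiber
`B^t`. -/
theorem tendsto_wasserstein_sinkPath (hb : IsAdmissibleField b) (hS : IsAdmissibleSink S)
    {m₀ : Measure (E d)} [IsFiniteMeasure m₀] (hac : initialMeasure S m₀ ≪ volume) (t : ℝ) :
    Tendsto (fun s => wasserstein (sinkPath b S m₀ s) (sinkPath b S m₀ t)) (𝓝 t) (𝓝 0) := by
  obtain ⟨M, hM⟩ := hb.bounded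
  have hM0 : 0 ≤ M := (norm_nonneg _).trans (hM 0 0)
  have hmeas : ∀ r, MeasurableSet (reachSet b S r) := fun r =>
    (isClosed_reachSet hb hS.isClosed r).measurableSet
  refine tendsto_of_tendsto_of_tendsto_of_le_of_le tendsto_const_nhds ?_ (fun s => zero_le)
    fun s => wasserstein_sinkPath_le hb hS.isClosed hM s t
  rw [← ENNReal.ofReal_zero]
  refine ENNReal.tendsto_ofReal ?_
  rw [← integral_zero (E d) ℝ (μ := initialMeasure S m₀)]
  refine tendsto_integral_filter_of_dominated_convergence (fun _ => M + 1) ?_ ?_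
    (integrable_const _) ?_
  · refine Eventually.of_forall fun s => Measurable.aestronglyMeasurable ?_
    exact measurable_const.add (((measurable_const.indicator (hmeas s)).sub
      (measurable_const.indicator (hmeas t))).abs)
  · filter_upwards [Metric.ball_mem_nhds t one_pos] with s hs
    refine Eventually.of_forall fun x => ?_
    rw [Metric.mem_ball, Real.dist_eq] at hs
    rw [Real.norm_of_nonneg (by positivity)]
    refine add_le_add (mul_le_of_le_one_right hM0 hs.le) ?_
    by_cases hxs : x ∈ reachSet b S s <;> by_cases hxt : x ∈ reachSet b S t <;> simp [hxs, hxt]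
  · have hnull := measure_reachFiber_eq_zero hb hS hac (initialMeasure_sink hS.isClosed m₀) t
    filter_upwards [measure_eq_zero_iff_ae_notMem.1 hnull] with x hx
    have h1 : Tendsto (fun s : ℝ => M * |s - t|) (𝓝 t) (𝓝 0) := by
      have : Continuous fun s : ℝ => M * |s - t| := by fun_prop
      simpa using this.tendsto t
    refine h1.congr' ?_
    filter_upwards [eventually_mem_reachSet_iff hx] with s hs
    by_cases hxt : x ∈ reachSet b S t <;> simp [hs, hxt]

theorem wasserstein_zero_le (μ : Measure (E d)) [IsFiniteMeasure μ] :
    wasserstein μ 0 ≤ μ univ := by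
  refine iSup₂_le fun φ hφ => ?_
  have h := norm_integral_le_of_norm_le_const (μ := μ) (f := φ) (C := 1)
    (Eventually.of_forall hφ.2.2.1)
  rw [one_mul] at h
  rw [integral_zero_measure, sub_zero]
  refine (ENNReal.ofReal_le_ofReal ((le_abs_self _).trans h)).trans ?_
  rw [ofReal_measureReal]

/-- The candidate is continuous in time for the generalized Wasserstein distance, hence strongly
measurable, and bounded. -/
theorem memL1Path_sinkPath (hb : IsAdmissibleField b) (hS : IsAdmissibleSink S) (T : ℝ) {G : ℝ≥0}
    {m₀ : Measure (E d)} (hm₀ : m₀ ∈ massSet d G) (hac : initialMeasure S m₀ ≪ volume) :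
    MemL1Path G T (sinkPath b S m₀) := by
  have := isFiniteMeasure_of_mem_massSet hm₀
  let ρ : ℝ → MassSpace d G := fun t => ⟨sinkPath b S m₀ t, sinkPath_mem_massSet hb hm₀ t⟩
  have hρ : Continuous ρ := continuous_iff_continuousAt.2 fun t =>
    tendsto_iff_edist_tendsto_0.2 (tendsto_wasserstein_sinkPath hb hS hac t)
  refine ⟨ρ, fun t _ => rfl, hρ.stronglyMeasurable.aestronglyMeasurable, ?_⟩
  have hle : ∀ t, edist (ρ t) (zeroMass d G) ≤ (G : ℝ≥0∞) := fun t => by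
    have := isFiniteMeasure_of_mem_massSet (ρ t).2
    exact (wasserstein_zero_le (ρ t).1).trans (ρ t).2.1
  refine (lintegral_mono hle).trans_lt ?_
  rw [lintegral_const, Measure.restrict_apply_univ]
  exact ENNReal.mul_lt_top ENNReal.coe_lt_top measure_Icc_lt_top

/-! ### The transport term -/

theorem transportTerm_eq {φ : E d × ℝ → ℝ} (hφ : Differentiable ℝ φ) (x : E d) (t : ℝ) :
    transportTerm b φ x t = fderiv ℝ φ (x, t) (b x t, 1) := by
  have h := (hφ (x, t)).hasFDerivAt
  have h1 : HasDerivAt (fun s => φ (x, s)) (fderiv ℝ φ (x, t) (0, 1)) t :=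
    h.comp_hasDerivAt t ((hasDerivAt_const t x).prodMk (hasDerivAt_id t))
  have h2 : HasFDerivAt (fun y => φ (y, t))
      ((fderiv ℝ φ (x, t)).comp (ContinuousLinearMap.inl ℝ (E d) ℝ)) x :=
    HasFDerivAt.comp (g := φ) x h (hasFDerivAt_prodMk_left x t)
  rw [transportTerm, h1.deriv, h2.fderiv, ContinuousLinearMap.comp_apply,
    ContinuousLinearMap.inl_apply, ← map_add, Prod.mk_add_mk, zero_add, add_zero]

/-- Along a trajectory, the transport term is the total derivative of the test function. -/
theorem hasDerivAt_comp_flow (hb : IsAdmissibleField b) {φ : E d × ℝ → ℝ}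
    (hφ : Differentiable ℝ φ) (x : E d) (t : ℝ) :
    HasDerivAt (fun s => φ (flow b x 0 s, s)) (transportTerm b φ (flow b x 0 t) t) t := by
  rw [transportTerm_eq hφ]
  exact HasFDerivAt.comp_hasDerivAt (l := φ) t (hφ _).hasFDerivAt
    ((hb.hasDerivAt_flow x 0 t).prodMk (hasDerivAt_id t))

theorem continuous_transportTerm (hb : IsAdmissibleField b) {φ : E d × ℝ → ℝ}
    (hφ : ContDiff ℝ 1 φ) : Continuous fun p : E d × ℝ => transportTerm b φ p.1 p.2 := by
  simp only [transportTerm_eq (hφ.differentiable one_ne_zero)]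
  exact (hφ.continuous_fderiv one_ne_zero).clm_apply (hb.continuous.prodMk continuous_const)

theorem exists_abs_transportTerm_le (hb : IsAdmissibleField b) {φ : E d × ℝ → ℝ}
    (hφ : ContDiff ℝ 1 φ) (hφc : HasCompactSupport φ) :
    ∃ C, ∀ x t, |transportTerm b φ x t| ≤ C := by
  obtain ⟨C, hC⟩ := (hφ.continuous_fderiv one_ne_zero).bounded_above_of_compact_support
    (hφc.fderiv (𝕜 := ℝ))
  obtain ⟨M, hM⟩ := hb.bounded
  refine ⟨C * max M 1, fun x t => ?_⟩
  rw [transportTerm_eq (hφ.differentiable one_ne_zero), ← Real.norm_eq_abs]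
  refine (ContinuousLinearMap.le_opNorm _ _).trans ?_
  have hC0 : 0 ≤ C := (norm_nonneg _).trans (hC (x, t))
  gcongr
  · exact hC _
  · rw [Prod.norm_def]
    exact max_le_max (hM x t) (by simp)

/-- Fundamental theorem of calculus along the part of a trajectory that precedes the arrival on the
sink: the trajectory stops at the arrival point, or else lasts until time `T`, where the test
function vanishes. -/
theorem integral_transportTerm_before_arrival (hb : IsAdmissibleField b) {T : ℝ} (hT : 0 ≤ T)
    {φ : E d × ℝ → ℝ} (hφ : ContDiff ℝ 1 φ) (hφT : ∀ x, φ (x, T) = 0) (x : E d) :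
    ∫ t in Ioc 0 T, {t | x ∉ reachSet b S t}.indicator
        (fun t => transportTerm b φ (flow b x 0 t) t) t =
      (reachSet b S T).indicator
        (fun x => φ (flow b x 0 (arrivalMap b S x), arrivalMap b S x)) x - φ (x, 0) := by
  have hcont : Continuous fun t => transportTerm b φ (flow b x 0 t) t :=
    (continuous_transportTerm hb hφ).comp ((hb.continuous_flow_zero.comp
      (continuous_const.prodMk continuous_id)).prodMk continuous_id)
  have hFTC : ∀ r, ∫ t in (0 : ℝ)..r, transportTerm b φ (flow b x 0 t) t =
      φ (flow b x 0 r, r) - φ (x, 0) := fun r => by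
    rw [intervalIntegral.integral_eq_sub_of_hasDerivAt
      (fun t _ => hasDerivAt_comp_flow hb (hφ.differentiable one_ne_zero) x t)
      (hcont.intervalIntegrable _ _), hb.flow_self]
  by_cases hx : x ∈ reachSet b S T
  · set τ := arrivalMap b S x with hτ
    have hτ0 : 0 ≤ τ := arrivalMap_nonneg x
    have hτT : τ ≤ T := (mem_reachSet_iff_arrivalMap_le hx).1 hx
    have hset : {t | x ∉ reachSet b S t} = Iio τ := by
      ext t
      rw [mem_ofPred_eq, mem_reachSet_iff_arrivalMap_le hx, not_le, mem_Iio]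
    have hinter : Ioc 0 T ∩ Iio τ = Ioo 0 τ := by
      ext t
      exact ⟨fun h => ⟨h.1.1, h.2⟩, fun h => ⟨⟨h.1, h.2.le.trans hτT⟩, h.2⟩⟩
    rw [hset, setIntegral_indicator measurableSet_Iio, hinter, ← integral_Ioc_eq_integral_Ioo,
      ← intervalIntegral.integral_of_le hτ0, hFTC, indicator_of_mem hx]
  · have hset : ∀ t ∈ Ioc 0 T, {t | x ∉ reachSet b S t}.indicator
        (fun t => transportTerm b φ (flow b x 0 t) t) t = transportTerm b φ (flow b x 0 t) t :=
      fun t ht => indicator_of_mem (s := {t | x ∉ reachSet b S t})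
        (fun h => hx (reachSet_mono ht.2 h)) _
    rw [setIntegral_congr_fun measurableSet_Ioc hset, ← intervalIntegral.integral_of_le hT, hFTC,
      hφT, indicator_of_notMem hx]

/-- The total time derivative of `φ` along the trajectory starting from `x`, set to zero from the
arrival on the sink onwards, as a function of `(x, t)`. -/
noncomputable def transportIntegrand (b : E d → ℝ → E d) (S : Set (E d)) (φ : E d × ℝ → ℝ) :
    E d × ℝ → ℝ :=
  {p | p.1 ∉ reachSet b S p.2}.indicator fun p => transportTerm b φ (flow b p.1 0 p.2) p.2

theorem integrable_transportIntegrand (hb : IsAdmissibleField b) (hS : IsClosed S)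
    {φ : E d × ℝ → ℝ} (hφ : ContDiff ℝ 1 φ) (hφc : HasCompactSupport φ)
    (μ : Measure (E d × ℝ)) [IsFiniteMeasure μ] :
    Integrable (transportIntegrand b S φ) μ := by
  obtain ⟨C, hC⟩ := exists_abs_transportTerm_le hb hφ hφc
  refine (Integrable.of_bound ?_ C (Eventually.of_forall fun p => hC _ _)).indicator
    (measurableSet_graph_reachSet hb hS).compl
  exact ((continuous_transportTerm hb hφ).comp
    (hb.continuous_flow_zero.prodMk continuous_snd)).aestronglyMeasurable

theorem setIntegral_transportTerm_sinkPath (hb : IsAdmissibleField b) (hS : IsClosed S)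
    {φ : E d × ℝ → ℝ} (hφ : ContDiff ℝ 1 φ) (m₀ : Measure (E d)) (t : ℝ) :
    ∫ x in (removedSet b S t)ᶜ, transportTerm b φ x t ∂(sinkPath b S m₀ t) =
      ∫ x, transportIntegrand b S φ (x, t) ∂(initialMeasure S m₀) := by
  have hrestr : (sinkPath b S m₀ t).restrict (removedSet b S t)ᶜ = sinkPath b S m₀ t := by
    rw [sinkPath, Measure.restrict_restrict (measurableSet_removedSet hb hS t).compl, inter_self]
  rw [hrestr, integral_sinkPath hb hS]
  · rfl
  · exact ((continuous_transportTerm hb hφ).comp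
      (continuous_id.prodMk continuous_const)).stronglyMeasurable

theorem intervalIntegrable_transport (hb : IsAdmissibleField b) (hS : IsClosed S) {T : ℝ}
    (hT : 0 ≤ T) {φ : E d × ℝ → ℝ} (hφ : ContDiff ℝ 1 φ) (hφc : HasCompactSupport φ)
    (m₀ : Measure (E d)) [IsFiniteMeasure m₀] :
    IntervalIntegrable (fun t => ∫ x in (removedSet b S t)ᶜ, transportTerm b φ x t
      ∂(sinkPath b S m₀ t)) volume 0 T := by
  simp only [setIntegral_transportTerm_sinkPath hb hS hφ]
  rw [intervalIntegrable_iff_integrableOn_Ioc_of_le hT]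
  exact (integrable_transportIntegrand hb hS hφ hφc
    ((initialMeasure S m₀).prod (volume.restrict (Ioc 0 T)))).integral_prod_right

/-- The transport integral is computed trajectory by trajectory, by Fubini's theorem. -/
theorem integral_transport (hb : IsAdmissibleField b) (hS : IsClosed S) {T : ℝ}
    (hT : 0 ≤ T) {φ : E d × ℝ → ℝ} (hφ : ContDiff ℝ 1 φ) (hφc : HasCompactSupport φ)
    (hφT : ∀ x, φ (x, T) = 0) (m₀ : Measure (E d)) [IsFiniteMeasure m₀] :
    ∫ t in (0 : ℝ)..T, ∫ x in (removedSet b S t)ᶜ, transportTerm b φ x t ∂(sinkPath b S m₀ t) =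
      ∫ x, ((reachSet b S T).indicator
        (fun x => φ (flow b x 0 (arrivalMap b S x), arrivalMap b S x)) x - φ (x, 0))
        ∂(initialMeasure S m₀) := by
  simp only [setIntegral_transportTerm_sinkPath hb hS hφ]
  rw [intervalIntegral.integral_of_le hT, ← integral_integral_swap
    (f := fun x t => transportIntegrand b S φ (x, t)) (integrable_transportIntegrand hb hS hφ hφc
      ((initialMeasure S m₀).prod (volume.restrict (Ioc 0 T))))]
  exact integral_congr_ae (Eventually.of_forall fun x =>
    integral_transportTerm_before_arrival hb hT hφ hφT x)

/-! ### The mass entering the sink -/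

/-- For positive `t` the entering measure is concentrated on `S^t`, and on the fiber `B^t` the time
`t` may be replaced by the arrival time. -/
theorem integral_enteringMeasure (hb : IsAdmissibleField b) (hS : IsClosed S) {φ : E d × ℝ → ℝ}
    {κ : ProbabilityTheory.Kernel ℝ (E d)} {g : ℝ → ℝ≥0} {t : ℝ} (ht : 0 < t)
    (h : g t ≠ 0 → ∀ᵐ x ∂(κ t), x ∈ reachFiber b S t) :
    ∫ x in arrivalSet b S t, φ (x, t) ∂(enteringMeasure b κ g t) =
      g t • ∫ x, φ (flow b x 0 (arrivalMap b S x), arrivalMap b S x) ∂(κ t) := by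
  by_cases hg : g t = 0
  · simp [enteringMeasure, hg]
  have hfib := h hg
  have hemb : MeasurableEmbedding fun x => flow b x 0 t :=
    (hb.continuous_flow_left 0 t).measurableEmbedding (hb.flow_injective 0 t)
  -- `S^t` need not be known to be measurable, because `Φ(·, 0, t)` is a measurable embedding.
  have hmem : ∀ᵐ z ∂((κ t).map fun x => flow b x 0 t), z ∈ arrivalSet b S t := by
    rw [hemb.ae_map_iff]
    filter_upwards [hfib] with x hx
    exact ⟨flow_mem_frontier hb hS ht hx, x, hx, rfl⟩
  rw [enteringMeasure, Measure.restrict_smul, Measure.restrict_eq_self_of_ae_mem hmem,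
    integral_smul_nnreal_measure, hemb.integral_map]
  congr 1
  refine integral_congr_ae ?_
  filter_upwards [hfib] with x hx
  simp only [arrivalMap_eq_of_mem_reachFiber hx]

theorem measurable_arrival_value (hb : IsAdmissibleField b) (hS : IsClosed S) {φ : E d × ℝ → ℝ}
    (hφ : Continuous φ) :
    Measurable fun x => φ (flow b x 0 (arrivalMap b S x), arrivalMap b S x) :=
  (hφ.comp (hb.continuous_flow_zero.prodMk continuous_snd)).measurable.comp
    (measurable_id.prodMk (measurable_arrivalMap hb hS))

section Entering

variable {T : ℝ} {m : Measure (E d)} [IsFiniteMeasure m]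
  {κ : ProbabilityTheory.Kernel ℝ (E d)} {g : ℝ → ℝ≥0}

theorem ae_integral_enteringMeasure (hb : IsAdmissibleField b) (hS : IsClosed S)
    (hκg : IsArrivalDisintegration b S T m κ g)
    (hκ : arrivalLaw b S T m ⊗ₘ κ = arrivalJointLaw b S T m) (φ : E d × ℝ → ℝ) :
    ∀ᵐ t ∂(volume.restrict (Icc 0 T)),
      ∫ x in arrivalSet b S t, φ (x, t) ∂(enteringMeasure b κ g t) =
        g t • ∫ x, φ (flow b x 0 (arrivalMap b S x), arrivalMap b S x) ∂(κ t) := by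
  have := hκg.isMarkov
  have h1 := ae_ae_mem_reachFiber hb hS hκ
  rw [hκg.law_eq, ae_withDensity_iff hκg.measurable_density.coe_nnreal_ennreal] at h1
  -- At time `0` the fiber is the whole sink, in general not contained in its boundary.
  have h2 : ∀ᵐ t ∂(volume.restrict (Icc 0 T)), t ≠ 0 :=
    ae_restrict_of_ae (Measure.ae_ne volume 0)
  filter_upwards [h1, h2, ae_restrict_mem measurableSet_Icc] with t ht ht0 htT
  exact integral_enteringMeasure hb hS (lt_of_le_of_ne htT.1 ht0.symm)
    fun hg => ht (ENNReal.coe_ne_zero.2 hg)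

theorem integrable_arrival_value_compProd (hb : IsAdmissibleField b) (hS : IsClosed S)
    (hκ : arrivalLaw b S T m ⊗ₘ κ = arrivalJointLaw b S T m)
    {φ : E d × ℝ → ℝ} (hφ : Continuous φ) (hφc : HasCompactSupport φ) :
    Integrable (fun p : ℝ × E d => φ (flow b p.2 0 (arrivalMap b S p.2), arrivalMap b S p.2))
      (arrivalLaw b S T m ⊗ₘ κ) := by
  obtain ⟨C, hC⟩ := hφ.bounded_above_of_compact_support hφc
  rw [hκ]
  exact Integrable.of_bound
    ((measurable_arrival_value hb hS hφ).comp measurable_snd).aestronglyMeasurable C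
    (Eventually.of_forall fun p => hC _)

theorem intervalIntegrable_entering (hb : IsAdmissibleField b) (hS : IsClosed S) (hT : 0 ≤ T)
    (hκg : IsArrivalDisintegration b S T m κ g)
    (hκ : arrivalLaw b S T m ⊗ₘ κ = arrivalJointLaw b S T m)
    {φ : E d × ℝ → ℝ} (hφ : Continuous φ) (hφc : HasCompactSupport φ) :
    IntervalIntegrable (fun t => ∫ x in arrivalSet b S t, φ (x, t) ∂(enteringMeasure b κ g t))
      volume 0 T := by
  have := hκg.isMarkov
  rw [intervalIntegrable_iff_integrableOn_Icc_of_le hT, IntegrableOn,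
    integrable_congr (ae_integral_enteringMeasure hb hS hκg hκ φ),
    ← integrable_withDensity_iff_integrable_smul hκg.measurable_density, ← hκg.law_eq]
  -- The product `⊗ₘ` of a measure and a kernel is a product of kernels over the one-point space.
  exact Integrable.integral_compProd
    (κ := ProbabilityTheory.Kernel.const Unit (arrivalLaw b S T m))
    (η := ProbabilityTheory.Kernel.prodMkLeft Unit κ) (a := ())
    (integrable_arrival_value_compProd hb hS hκ hφ hφc)

/-- The total mass entering the sink, tested against `φ`, is an integral over the points of `B(T)`,
because the kernel disintegrates the initial datum along the arrival time. -/
theorem integral_entering (hb : IsAdmissibleField b) (hS : IsClosed S) (hT : 0 ≤ T)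
    (hκg : IsArrivalDisintegration b S T m κ g)
    (hκ : arrivalLaw b S T m ⊗ₘ κ = arrivalJointLaw b S T m)
    {φ : E d × ℝ → ℝ} (hφ : Continuous φ) (hφc : HasCompactSupport φ) :
    ∫ t in (0 : ℝ)..T, ∫ x in arrivalSet b S t, φ (x, t) ∂(enteringMeasure b κ g t) =
      ∫ x, (reachSet b S T).indicator
        (fun x => φ (flow b x 0 (arrivalMap b S x), arrivalMap b S x)) x ∂m := by
  have := hκg.isMarkov
  rw [intervalIntegral.integral_of_le hT, ← integral_Icc_eq_integral_Ioc,
    integral_congr_ae (ae_integral_enteringMeasure hb hS hκg hκ φ),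
    ← integral_withDensity_eq_integral_smul hκg.measurable_density, ← hκg.law_eq,
    ← Measure.integral_compProd (integrable_arrival_value_compProd hb hS hκ hφ hφc), hκ,
    integral_indicator (isClosed_reachSet hb hS T).measurableSet]
  exact integral_map (measurable_arrivalMap_prodMk hb hS).aemeasurable
    ((measurable_arrival_value hb hS hφ).comp measurable_snd).aestronglyMeasurable

end Entering

theorem isWeakSolution_sinkPath (hb : IsAdmissibleField b) (hS : IsAdmissibleSink S) {T : ℝ}
    (hT : 0 < T) {G : ℝ≥0} {m₀ : Measure (E d)} (hm₀ : m₀ ∈ massSet d G)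
    (hdens : HasBoundedCompactDensity (initialMeasure S m₀)) :
    IsWeakSolution b S T G (initialMeasure S m₀) (sinkPath b S m₀) := by
  have hfin := isFiniteMeasure_of_mem_massSet hm₀
  have hSc := hS.isClosed
  have hac : initialMeasure S m₀ ≪ volume := by
    obtain ⟨ρ, -, -, -, hρ⟩ := hdens
    rw [hρ]
    exact withDensity_absolutelyContinuous _ _
  obtain ⟨κ, g, hκg, hκ⟩ :=
    exists_isArrivalDisintegration hb hS T hac (initialMeasure_sink hSc m₀)
  refine ⟨memL1Path_sinkPath hb hS T hm₀ hac, κ, g, by rwa [sinkPath_zero hb hSc], ?_⟩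
  rintro φ ⟨hφ, hφc, hφT⟩
  have hφ1 : ContDiff ℝ 1 φ := hφ.of_le (by exact_mod_cast le_top)
  have hφT' : ∀ x, φ (x, T) = 0 := fun x =>
    image_eq_zero_of_notMem_tsupport fun h => lt_irrefl T (hφT h).2
  refine ⟨intervalIntegrable_transport hb hSc hT.le hφ1 hφc m₀,
    intervalIntegrable_entering hb hSc hT.le hκg hκ hφ.continuous hφc, ?_⟩
  obtain ⟨C, hC⟩ := hφ.continuous.bounded_above_of_compact_support hφc
  have hint0 : Integrable (fun x => φ (x, 0)) (initialMeasure S m₀) :=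
    Integrable.of_bound (hφ.continuous.comp
      (continuous_id.prodMk continuous_const)).aestronglyMeasurable C
      (Eventually.of_forall fun x => hC _)
  have hint1 : Integrable ((reachSet b S T).indicator
      fun x => φ (flow b x 0 (arrivalMap b S x), arrivalMap b S x)) (initialMeasure S m₀) :=
    (Integrable.of_bound (measurable_arrival_value hb hSc hφ.continuous).aestronglyMeasurable C
      (Eventually.of_forall fun x => hC _)).indicator (isClosed_reachSet hb hSc T).measurableSet
  rw [integral_transport hb hSc hT.le hφ1 hφc hφT' m₀,
    integral_entering hb hSc hT.le hκg hκ hφ.continuous hφc, integral_sub hint1 hint0]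
  ring

end SinkFlow

theorem mainTheorem1 (d : ℕ) (b : SinkFlow.E d → ℝ → SinkFlow.E d)
    (hb : SinkFlow.IsAdmissibleField b)
    (S : Set (SinkFlow.E d)) (hS : SinkFlow.IsAdmissibleSink S)
    (T : ℝ) (hT : 0 < T) (G : ℝ≥0)
    (m₀ : Measure (SinkFlow.E d)) (hm₀ : m₀ ∈ SinkFlow.massSet d G)
    (hdens : SinkFlow.HasBoundedCompactDensity (SinkFlow.initialMeasure S m₀))
    (hπ : ∀ s ∈ Icc 0 T, ∃ K : ℝ≥0,
      LipschitzOnWith K (SinkFlow.arrivalMap b S) (SinkFlow.reachSet b S s)) :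
    SinkFlow.IsWeakSolution b S T G (SinkFlow.initialMeasure S m₀)
      (SinkFlow.sinkPath b S m₀) :=
  SinkFlow.isWeakSolution_sinkPath hb hS hT hm₀ hdens
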